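/- Let $\mathbb F$ be a field of characteristic zero, let $N,T,t,d,k,\Delta\ge 0$ be integers, and fix any monomial ordering on the monomials in $X_1,\dots,X_N$. Let $P\in\mathbb F[X_1,\dots,X_N]$ be a nonzero homogeneous polynomial of degree $\Delta$ such that $$P=\sum_{i=1}^T C_i(Q_{i1},Q_{i2},\dots,Q_{it}),$$ where each $C_i$ is a polynomial in $t$ variables over $\mathbb F$, each $Q_{ij}\in\mathbb F[X_1,\dots,X_N]$ has degree at most $d$, and for each $i\in\{1,\dots,T\}$ the algebraic rank of the set $\{Q_{ij}: 1\le j\le t\}$, that is, the size of a maximal subset of it that is algebraically independent over $\mathbb F$, is at most $k$. Then the trailing monomial of $P$ (the smallest monomial, in the given ordering, with nonzero coefficient in $P$) has support at most $$2e^3 d\cdot\bigl(\ln(T(\Delta+1))+(d+1)k\,\ln(2(d+1)k)+1\bigr),$$ that is, at most this many variables occur in it with nonzero exponent. Here $e$ is the base of the natural logarithm, and $0\ln 0$ is read as $0$ when $k=0$. -/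

import Mathlib

open MvPolynomial
open scoped MonomialOrder

/-- `B` is a transcendence basis of the set `S` of polynomials: a maximal subset of `S`
which is algebraically independent over `F`. -/
def IsTransBasisOfSet {σ F : Type*} [Field F] (S B : Set (MvPolynomial σ F)) : Prop :=
  Maximal (fun B : Set (MvPolynomial σ F) =>
    B ⊆ S ∧ AlgebraicIndependent F (fun q : B => (q : MvPolynomial σ F))) B

/-- The algebraic rank of a set `S` of polynomials: the size of a transcendence basis of `S`.
All of them have the same size (`algebraicRank_eq_encard`), so the supremum is that size. -/
noncomputable def algebraicRank {σ F : Type*} [Field F] (S : Set (MvPolynomial σ F)) : ℕ∞ :=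
  ⨆ B : {B : Set (MvPolynomial σ F) // IsTransBasisOfSet S B}, B.1.encard

/-- `α` is (the exponent vector of) the trailing monomial of `P` with respect to the monomial
ordering `m`: the minimal one among the monomials with a nonzero coefficient in `P`. -/
def IsTrailingMonomial {σ F : Type*} [Field F] (m : MonomialOrder σ) (P : MvPolynomial σ F)
    (α : σ →₀ ℕ) : Prop :=
  α ∈ P.support ∧ ∀ β ∈ P.support, α ≼[m] β

theorem IsTransBasisOfSet.isBasis {σ F : Type*} [Field F] {S B : Set (MvPolynomial σ F)}
    (h : IsTransBasisOfSet S B) :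
    (AlgebraicIndependent.matroid F (MvPolynomial σ F)).IsBasis B S := by
  rw [Matroid.isBasis_iff]
  refine ⟨h.prop.2, h.prop.1, fun J hJ hBJ hJS => ?_⟩
  exact le_antisymm hBJ (h.le_of_ge ⟨hJS, hJ⟩ hBJ)

theorem algebraicRank_eq_encard {σ F : Type*} [Field F] {S B : Set (MvPolynomial σ F)}
    (h : IsTransBasisOfSet S B) : algebraicRank S = B.encard := by
  refine le_antisymm (iSup_le fun B' => ?_)
    (le_iSup (fun B : {B : Set (MvPolynomial σ F) // IsTransBasisOfSet S B} => B.1.encard) ⟨B, h⟩)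
  rw [B'.2.isBasis.encard_eq_eRk, h.isBasis.encard_eq_eRk]

/-!
After the variables are translated to a generic point, each `C i (Q i 1, …, Q i t)` is a simple
root of a polynomial over the algebra generated by the homogeneous components of a translated
transcendence basis of `{Q i j}`. Newton's iteration approximates it to every order by elements of
this algebra, which is graded and therefore contains it. Taking components of degree `Δ` undoes
the translation of `P`, so `P` is a sum of `T` polynomials, each of them a composition with at most
`(d + 1) * k` polynomials of degree at most `d`.

By the chain rule, the shifted partial derivatives of such a sum span a space of small dimension.
On the other hand, once the variables outside the support of the trailing monomial are set to zero,
the derivatives of `P` that are of order at most one in each variable have distinct trailing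
monomials, and suitable shifts of them are linearly independent. With `N` variables left, the two
dimensions are compared for derivatives of order `⌊log T + (d + 1) * k * log 2 + 1⌋` and shifts of
degree at most `N * (d - 1)`.
-/

section Translation

variable {σ τ R : Type*} [CommSemiring R]

theorem totalDegree_aeval_le_of_forall_le_one {g : σ → MvPolynomial τ R}
    (hg : ∀ i, (g i).totalDegree ≤ 1) (p : MvPolynomial σ R) :
    (aeval g p).totalDegree ≤ p.totalDegree := by
  rw [aeval_def, eval₂_eq]
  refine totalDegree_finsetSum_le fun s hs => ?_
  calc (C (coeff s p) * ∏ i ∈ s.support, g i ^ s i).totalDegree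
      ≤ 0 + ∑ i ∈ s.support, s i * 1 := by
        refine (totalDegree_mul _ _).trans (add_le_add (totalDegree_C _).le ?_)
        refine (totalDegree_finsetProd _ _).trans (Finset.sum_le_sum fun i _ => ?_)
        exact (totalDegree_pow _ _).trans (Nat.mul_le_mul_left _ (hg i))
    _ ≤ p.totalDegree := by
        simpa only [zero_add, mul_one, Finsupp.sum] using le_totalDegree hs

theorem homogeneousComponent_add_mul {p q : MvPolynomial σ R} {a b : ℕ}
    (hp : p.totalDegree ≤ a) (hq : q.totalDegree ≤ b) :
    homogeneousComponent (a + b) (p * q) =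
      homogeneousComponent a p * homogeneousComponent b q := by
  classical
  ext s
  simp only [coeff_homogeneousComponent, coeff_mul, Finset.ite_sum_zero]
  refine Finset.sum_congr rfl fun ⟨u, v⟩ huv => ?_
  have hdegree : s.degree = u.degree + v.degree := by
    rw [← Finset.HasAntidiagonal.mem_antidiagonal.1 huv, map_add]
  have hu : coeff u p ≠ 0 → u.degree ≤ a := fun h =>
    (le_totalDegree (mem_support_iff.2 h)).trans hp
  have hv : coeff v q ≠ 0 → v.degree ≤ b := fun h =>
    (le_totalDegree (mem_support_iff.2 h)).trans hq
  by_cases h : coeff u p = 0 ∨ coeff v q = 0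
  · rcases h with h | h <;> simp [h]
  · grind

/-- The translation `X i ↦ X i + a i`. -/
noncomputable def translateVars (a : σ → R) : MvPolynomial σ R →ₐ[R] MvPolynomial σ R :=
  aeval fun i => X i + C (a i)

theorem translateVars_X (a : σ → R) (i : σ) : translateVars a (X i) = X i + C (a i) :=
  aeval_X _ _

theorem totalDegree_X_add_C_le (i : σ) (c : R) :
    (X i + C c : MvPolynomial σ R).totalDegree ≤ 1 :=
  (totalDegree_add _ _).trans (max_le (isHomogeneous_X R i).totalDegree_le (by simp))

theorem totalDegree_translateVars_le (a : σ → R) (p : MvPolynomial σ R) :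
    (translateVars a p).totalDegree ≤ p.totalDegree :=
  totalDegree_aeval_le_of_forall_le_one (fun i => totalDegree_X_add_C_le i (a i)) p

theorem constantCoeff_translateVars (a : σ → R) (p : MvPolynomial σ R) :
    constantCoeff (translateVars a p) = eval a p := by
  have : constantCoeff.comp (translateVars a).toRingHom = eval a := by
    ext i <;> simp [translateVars]
  exact congrArg (· p) this

theorem exists_homogeneousComponent_translateVars_monomial (a : σ → R) (s : σ →₀ ℕ) (c : R) :
    ∃ n, (monomial s c).IsHomogeneous n ∧
      homogeneousComponent n (translateVars a (monomial s c)) = monomial s c := by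
  refine induction_on_monomial (motive := fun p => ∃ n, p.IsHomogeneous n ∧
    homogeneousComponent n (translateVars a p) = p) (fun c => ?_) ?_ s c
  · exact ⟨0, isHomogeneous_C _ _, by simp [translateVars]⟩
  · rintro p i ⟨n, hp, hcomp⟩
    refine ⟨n + 1, hp.mul (isHomogeneous_X _ _), ?_⟩
    rw [map_mul, translateVars_X, homogeneousComponent_add_mul
      ((totalDegree_translateVars_le a p).trans hp.totalDegree_le) (totalDegree_X_add_C_le i _),
      hcomp, map_add, homogeneousComponent_eq_self (isHomogeneous_X R i),
      homogeneousComponent_of_mem (isHomogeneous_C σ _), if_neg zero_ne_one.symm, add_zero]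

theorem homogeneousComponent_translateVars (a : σ → R) {p : MvPolynomial σ R} {n : ℕ}
    (hp : p.IsHomogeneous n) : homogeneousComponent n (translateVars a p) = p := by
  nth_rw 1 [p.as_sum]
  rw [map_sum, map_sum]
  nth_rw 3 [p.as_sum]
  refine Finset.sum_congr rfl fun s hs => ?_
  obtain ⟨r, hr, hcomp⟩ := exists_homogeneousComponent_translateVars_monomial a s (coeff s p)
  have hs' : coeff s p ≠ 0 := mem_support_iff.1 hs
  have hn : (monomial s (coeff s p)).IsHomogeneous n :=
    isHomogeneous_monomial _ (not_imp_comm.1 hp.coeff_eq_zero hs')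
  rwa [hr.inj_right hn (monomial_eq_zero.not.2 hs')] at hcomp

end Translation

section SimpleRoot

/-- Newton's iteration: a simple root is approximated to every order by elements of the ring of
coefficients. -/
theorem exists_sub_algebraMap_mem_pow {R A : Type*} [CommRing R] [CommRing A] [Algebra R A]
    {I : Ideal A} {f : Polynomial R} {z : A} (hz : Polynomial.aeval z f = 0) {u : R}
    (hu : 1 - algebraMap R A u * Polynomial.aeval z f.derivative ∈ I) {s₀ : R}
    (hs₀ : z - algebraMap R A s₀ ∈ I) (r : ℕ) : ∃ s : R, z - algebraMap R A s ∈ I ^ (r + 1) := by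
  induction r with
  | zero => exact ⟨s₀, by simpa only [zero_add, pow_one] using hs₀⟩
  | succ r ih =>
    obtain ⟨s, hs⟩ := ih
    refine ⟨s - u * f.eval s, ?_⟩
    obtain ⟨c, hc⟩ := (f.map (algebraMap R A)).binomExpansion z (algebraMap R A s - z)
    rw [add_sub_cancel, Polynomial.derivative_map] at hc
    simp only [Polynomial.eval_map_algebraMap] at hc
    rw [hz, zero_add, Polynomial.aeval_algebraMap_apply_eq_algebraMap_eval] at hc
    have hstep : z - algebraMap R A (s - u * f.eval s) = (z - algebraMap R A s) *
        ((1 - algebraMap R A u * Polynomial.aeval z f.derivative) +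
          algebraMap R A u * c * (z - algebraMap R A s)) := by
      rw [map_sub, map_mul, hc]
      ring
    rw [hstep, pow_succ]
    exact Ideal.mul_mem_mul hs
      (I.add_mem hu (I.mul_mem_left _ (Ideal.pow_le_self r.succ_ne_zero hs)))

theorem exists_aeval_derivative_ne_zero_of_isAlgebraic {K A : Type*} [CommRing K]
    [NoZeroDivisors K] [CharZero K] [CommRing A] [Algebra K A] [FaithfulSMul K A] {z : A}
    (hz : IsAlgebraic K z) :
    ∃ p : Polynomial K, Polynomial.aeval z p = 0 ∧ Polynomial.aeval z p.derivative ≠ 0 := by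
  obtain ⟨p, ⟨hp0, hp⟩, hmin⟩ := exists_minimalFor_of_wellFoundedLT _ Polynomial.natDegree hz
  have hpos : p.natDegree ≠ 0 := fun h => by
    rw [Polynomial.eq_C_of_natDegree_eq_zero h] at hp0 hp
    rw [Polynomial.aeval_C, FaithfulSMul.algebraMap_eq_zero_iff] at hp
    exact hp0 (by rw [hp, map_zero])
  have hlt := Polynomial.natDegree_derivative_lt hpos
  refine ⟨p, hp, fun hp' => hlt.not_ge (hmin ⟨?_, hp'⟩ hlt.le)⟩
  exact Polynomial.derivative_ne_zero.2 hpos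

end SimpleRoot

section HomogeneousGenerators

theorem isHomogeneous_of_mem_closure {σ R : Type*} [CommSemiring R]
    {G : Set (MvPolynomial σ R)} (hG : ∀ g ∈ G, ∃ n, g.IsHomogeneous n) {p : MvPolynomial σ R}
    (hp : p ∈ Submonoid.closure G) : ∃ n, p.IsHomogeneous n := by
  induction hp using Submonoid.closure_induction with
  | mem p hp => exact hG p hp
  | one => exact ⟨0, isHomogeneous_one _ _⟩
  | mul p q _ _ hp hq =>
    obtain ⟨a, ha⟩ := hp
    obtain ⟨b, hb⟩ := hq
    exact ⟨a + b, ha.mul hb⟩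

theorem homogeneousComponent_mem_adjoin {σ R : Type*} [CommSemiring R]
    {G : Set (MvPolynomial σ R)} (hG : ∀ g ∈ G, ∃ n, g.IsHomogeneous n) {p : MvPolynomial σ R}
    (hp : p ∈ Algebra.adjoin R G) (r : ℕ) : homogeneousComponent r p ∈ Algebra.adjoin R G := by
  classical
  rw [← Subalgebra.mem_toSubmodule, Algebra.adjoin_eq_span] at hp ⊢
  refine Submodule.span_le (p := (Submodule.span R _).comap (homogeneousComponent r)).2 ?_ hp
  intro q hq
  obtain ⟨n, hn⟩ := isHomogeneous_of_mem_closure hG hq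
  rw [SetLike.mem_coe, Submodule.mem_comap, homogeneousComponent_of_mem hn]
  split_ifs
  · exact Submodule.subset_span hq
  · exact zero_mem _

theorem homogeneousComponent_eq_zero_of_mem_pow_idealOfVars {σ R : Type*} [CommRing R]
    {p : MvPolynomial σ R} {r : ℕ} (hp : p ∈ idealOfVars σ R ^ (r + 1)) :
    homogeneousComponent r p = 0 := by
  ext s
  rw [coeff_homogeneousComponent, coeff_zero, ite_eq_right_iff]
  rintro rfl
  exact (mem_pow_idealOfVars_iff' _ _).1 hp s (Nat.lt_succ_self _)

theorem mem_idealOfVars_iff_constantCoeff_eq_zero {σ R : Type*} [CommRing R]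
    {p : MvPolynomial σ R} : p ∈ idealOfVars σ R ↔ constantCoeff p = 0 := by
  rw [← pow_one (idealOfVars σ R), mem_pow_idealOfVars_iff']
  simp only [Nat.lt_one_iff, Finsupp.degree_eq_zero_iff, forall_eq, constantCoeff_eq]

variable {σ F : Type*} [Field F]

theorem mem_adjoin_of_constantCoeff_aeval_derivative_ne_zero {G : Set (MvPolynomial σ F)}
    (hG : ∀ g ∈ G, ∃ n, g.IsHomogeneous n) {f : Polynomial (Algebra.adjoin F G)}
    {z : MvPolynomial σ F} (hz : Polynomial.aeval z f = 0)
    (hz' : constantCoeff (Polynomial.aeval z f.derivative) ≠ 0) : z ∈ Algebra.adjoin F G := by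
  rw [← sum_homogeneousComponent z]
  refine Subalgebra.sum_mem _ fun r _ => ?_
  have hu : 1 - algebraMap (Algebra.adjoin F G) (MvPolynomial σ F)
      (algebraMap F _ (constantCoeff (Polynomial.aeval z f.derivative))⁻¹) *
      Polynomial.aeval z f.derivative ∈ idealOfVars σ F := by
    rw [mem_idealOfVars_iff_constantCoeff_eq_zero, ← IsScalarTower.algebraMap_apply,
      algebraMap_eq, map_sub, map_one, map_mul, constantCoeff_C, inv_mul_cancel₀ hz', sub_self]
  have hs₀ : z - algebraMap (Algebra.adjoin F G) (MvPolynomial σ F)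
      (algebraMap F _ (constantCoeff z)) ∈ idealOfVars σ F := by
    rw [mem_idealOfVars_iff_constantCoeff_eq_zero, ← IsScalarTower.algebraMap_apply,
      algebraMap_eq, map_sub, constantCoeff_C, sub_self]
  obtain ⟨s, hs⟩ := exists_sub_algebraMap_mem_pow hz hu hs₀ r
  have hcomp := homogeneousComponent_eq_zero_of_mem_pow_idealOfVars hs
  rw [map_sub, sub_eq_zero] at hcomp
  rw [hcomp]
  exact homogeneousComponent_mem_adjoin hG s.2 r

/-- The homogeneous components of the translates by `a` of the elements of `B`, up to
degree `d`: generators of an algebra containing these translates, if `B` has degree at most `d`. -/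
noncomputable def translateComponents [DecidableEq (MvPolynomial σ F)] (a : σ → F)
    (B : Finset (MvPolynomial σ F)) (d : ℕ) : Finset (MvPolynomial σ F) :=
  (B ×ˢ Finset.range (d + 1)).image fun x => homogeneousComponent x.2 (translateVars a x.1)

variable [DecidableEq (MvPolynomial σ F)] {a : σ → F} {B : Finset (MvPolynomial σ F)}
  {d : ℕ}

theorem card_translateComponents_le : (translateComponents a B d).card ≤ B.card * (d + 1) :=
  Finset.card_image_le.trans (by rw [Finset.card_product, Finset.card_range])

theorem exists_isHomogeneous_of_mem_translateComponents {g : MvPolynomial σ F}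
    (hg : g ∈ translateComponents a B d) : ∃ n ≤ d, g.IsHomogeneous n := by
  obtain ⟨⟨b, n⟩, hbn, rfl⟩ := Finset.mem_image.1 hg
  exact ⟨n, Finset.mem_range_succ_iff.1 (Finset.mem_product.1 hbn).2,
    homogeneousComponent_isHomogeneous _ _⟩

theorem translateVars_mem_adjoin_translateComponents (hB : ∀ b ∈ B, b.totalDegree ≤ d)
    {b : MvPolynomial σ F} (hb : b ∈ Algebra.adjoin F (B : Set (MvPolynomial σ F))) :
    translateVars a b ∈
      Algebra.adjoin F (translateComponents a B d : Set (MvPolynomial σ F)) := by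
  refine (Algebra.adjoin_le (S := (Algebra.adjoin F _).comap (translateVars a)) ?_) hb
  intro b hb
  rw [SetLike.mem_coe, Subalgebra.mem_comap, ← sum_homogeneousComponent (translateVars a b)]
  refine Subalgebra.sum_mem _ fun r hr => Algebra.subset_adjoin ?_
  have hr' : r < d + 1 := (Finset.mem_range.1 hr).trans_le <|
    Nat.succ_le_succ ((totalDegree_translateVars_le a b).trans (hB b hb))
  exact Finset.mem_image.2 ⟨(b, r), Finset.mem_product.2 ⟨hb, Finset.mem_range.2 hr'⟩, rfl⟩

theorem translateVars_mem_adjoin_of_aeval_eq_zero (hB : ∀ b ∈ B, b.totalDegree ≤ d)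
    {p : Polynomial (Algebra.adjoin F (B : Set (MvPolynomial σ F)))} {z : MvPolynomial σ F}
    (hz : Polynomial.aeval z p = 0) (hz' : eval a (Polynomial.aeval z p.derivative) ≠ 0) :
    translateVars a z ∈
      Algebra.adjoin F (translateComponents a B d : Set (MvPolynomial σ F)) := by
  set φ := ((translateVars a).comp (Algebra.adjoin F (B : Set (MvPolynomial σ F))).val).codRestrict
    (Algebra.adjoin F (translateComponents a B d : Set (MvPolynomial σ F)))
    (fun b => translateVars_mem_adjoin_translateComponents hB b.2)
  have haeval : ∀ q : Polynomial (Algebra.adjoin F (B : Set (MvPolynomial σ F))),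
      Polynomial.aeval (translateVars a z) (q.map φ.toRingHom) =
        translateVars a (Polynomial.aeval z q) := fun q => by
    rw [Polynomial.aeval_def, Polynomial.eval₂_map, Polynomial.aeval_def, ← AlgHom.coe_toRingHom,
      Polynomial.hom_eval₂]
    rfl
  refine mem_adjoin_of_constantCoeff_aeval_derivative_ne_zero (f := p.map φ.toRingHom)
    (fun g hg => ?_) ?_ ?_
  · obtain ⟨n, -, hn⟩ := exists_isHomogeneous_of_mem_translateComponents hg
    exact ⟨n, hn⟩
  · rw [haeval, hz, map_zero]
  · rwa [Polynomial.derivative_map, haeval, constantCoeff_translateVars]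

end HomogeneousGenerators

section AlgebraicRank

variable {σ F : Type*} [Field F]

theorem exists_isTransBasisOfSet (S : Set (MvPolynomial σ F)) : ∃ B, IsTransBasisOfSet S B := by
  obtain ⟨B, hB⟩ := (AlgebraicIndependent.matroid F (MvPolynomial σ F)).exists_isBasis S
  exact ⟨B, ⟨hB.subset, hB.indep⟩, fun J hJ hBJ => (hB.eq_of_subset_indep hJ.2 hBJ hJ.1).ge⟩

theorem IsTransBasisOfSet.isAlgebraic_of_mem_adjoin {S B : Set (MvPolynomial σ F)}
    (hB : IsTransBasisOfSet S B) {z : MvPolynomial σ F} (hz : z ∈ Algebra.adjoin F S) :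
    IsAlgebraic (Algebra.adjoin F B) z := by
  have hS : Algebra.adjoin F S ≤ (Subalgebra.algebraicClosure (Algebra.adjoin F B)
      (MvPolynomial σ F)).restrictScalars F :=
    Algebra.adjoin_le (AlgebraicIndependent.matroid_isBasis_iff.1 hB.isBasis).2.2
  exact hS hz

theorem exists_finset_isTransBasisOfSet {S : Set (MvPolynomial σ F)} {k : ℕ}
    (hS : algebraicRank S ≤ k) :
    ∃ B : Finset (MvPolynomial σ F), IsTransBasisOfSet S (B : Set (MvPolynomial σ F)) ∧
      B.card ≤ k := by
  obtain ⟨B, hB⟩ := exists_isTransBasisOfSet S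
  rw [algebraicRank_eq_encard hB] at hS
  lift B to Finset (MvPolynomial σ F) using Set.finite_of_encard_le_coe hS
  exact ⟨B, hB, by rwa [Set.encard_coe_eq_coe_finsetCard, Nat.cast_le] at hS⟩

theorem exists_forall_eval_ne_zero {ι : Type*} [Finite ι] {R : Type*} [CommRing R] [IsDomain R]
    [Infinite R] {p : ι → MvPolynomial σ R} (hp : ∀ i, p i ≠ 0) : ∃ a, ∀ i, eval a (p i) ≠ 0 := by
  cases nonempty_fintype ι
  by_contra! h
  refine Finset.prod_ne_zero_iff.2 (fun i _ => hp i) (MvPolynomial.funext fun a => ?_ :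
    ∏ i, p i = 0)
  obtain ⟨i, hi⟩ := h a
  rw [map_prod, map_zero]
  exact Finset.prod_eq_zero (Finset.mem_univ i) hi

theorem exists_sum_eq_of_algebraicRank_le [CharZero F] {ι κ : Type*} [Fintype ι] {d k Δ : ℕ}
    {P : MvPolynomial σ F} (hP : P.IsHomogeneous Δ) {C : ι → MvPolynomial κ F}
    {Q : ι → κ → MvPolynomial σ F} (hrep : P = ∑ i, aeval (Q i) (C i))
    (hdeg : ∀ i j, (Q i j).totalDegree ≤ d)
    (hrank : ∀ i, algebraicRank (Set.range (Q i)) ≤ (k : ℕ∞)) :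
    ∃ (G : ι → Finset (MvPolynomial σ F)) (q : ι → MvPolynomial σ F),
      (∀ i, (G i).card ≤ (d + 1) * k) ∧ (∀ i, ∀ g ∈ G i, g.totalDegree ≤ d) ∧
      (∀ i, q i ∈ Algebra.adjoin F (G i : Set (MvPolynomial σ F))) ∧ P = ∑ i, q i := by
  classical
  choose B hB hBcard using fun i => exists_finset_isTransBasisOfSet (hrank i)
  have hBdeg : ∀ i, ∀ b ∈ B i, b.totalDegree ≤ d := fun i b hb => by
    obtain ⟨j, rfl⟩ := (hB i).prop.1 hb
    exact hdeg i j
  have halg : ∀ i, IsAlgebraic (Algebra.adjoin F (B i : Set (MvPolynomial σ F)))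
      (aeval (Q i) (C i)) := fun i => (hB i).isAlgebraic_of_mem_adjoin <| by
    rw [Algebra.adjoin_range_eq_range_aeval]
    exact AlgHom.mem_range_self _ _
  choose f hf hf' using fun i => exists_aeval_derivative_ne_zero_of_isAlgebraic (halg i)
  obtain ⟨a, ha⟩ := exists_forall_eval_ne_zero hf'
  refine ⟨fun i => translateComponents a (B i) d,
    fun i => homogeneousComponent Δ (translateVars a (aeval (Q i) (C i))),
    fun i => ?_, fun i g hg => ?_, fun i => ?_, ?_⟩
  · rw [mul_comm]
    exact card_translateComponents_le.trans (Nat.mul_le_mul_right _ (hBcard i))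
  · obtain ⟨n, hn, hg⟩ := exists_isHomogeneous_of_mem_translateComponents hg
    exact hg.totalDegree_le.trans hn
  · refine homogeneousComponent_mem_adjoin (fun g hg => ?_)
      (translateVars_mem_adjoin_of_aeval_eq_zero (hBdeg i) (hf i) (ha i)) Δ
    obtain ⟨n, -, hn⟩ := exists_isHomogeneous_of_mem_translateComponents hg
    exact ⟨n, hn⟩
  · rw [← map_sum, ← map_sum, ← hrep, homogeneousComponent_translateVars a hP]

end AlgebraicRank

section IteratedDerivative

variable {σ R : Type*} [CommSemiring R]

theorem commute_pderiv (i j : σ) :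
    Commute (pderiv i : Derivation R (MvPolynomial σ R) _).toLinearMap (pderiv j).toLinearMap := by
  classical
  refine LinearMap.ext fun p => MvPolynomial.ext _ _ fun m => ?_
  simp only [Module.End.mul_apply, Derivation.coeFn_coe,
    coeff_pderiv, add_right_comm m (Finsupp.single j 1)]
  obtain rfl | hij := eq_or_ne i j
  · rfl
  · simp only [Finsupp.add_apply, Finsupp.single_eq_of_ne hij, Finsupp.single_eq_of_ne hij.symm,
      add_zero, mul_right_comm]

/-- The iterated partial derivative `∂^s`, in which the variable `i` is derived `s i` times. -/
noncomputable def iteratedPDeriv (s : σ →₀ ℕ) : Module.End R (MvPolynomial σ R) :=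
  (Finsupp.toMultiset s |>.map fun i => (pderiv i).toLinearMap).noncommProd
    fun x hx y hy _ => by
      obtain ⟨i, -, rfl⟩ := Multiset.mem_map.1 hx
      obtain ⟨j, -, rfl⟩ := Multiset.mem_map.1 hy
      exact commute_pderiv i j

theorem iteratedPDeriv_zero (p : MvPolynomial σ R) : iteratedPDeriv 0 p = p := by
  simp [iteratedPDeriv]

theorem iteratedPDeriv_single_add (i : σ) (s : σ →₀ ℕ) (p : MvPolynomial σ R) :
    iteratedPDeriv (Finsupp.single i 1 + s) p = pderiv i (iteratedPDeriv s p) := by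
  simp [iteratedPDeriv]

theorem induction_single_add {σ : Type*} {motive : (σ →₀ ℕ) → Prop} (s : σ →₀ ℕ)
    (zero : motive 0) (single_add : ∀ i s, motive s → motive (Finsupp.single i 1 + s)) :
    motive s := by
  classical
  obtain ⟨s, rfl⟩ := Multiset.toFinsupp.surjective s
  induction s using Multiset.induction with
  | empty => simpa only [map_zero] using zero
  | cons i s ih =>
    rw [← Multiset.singleton_add, map_add, Multiset.toFinsupp_singleton]
    exact single_add i _ ih

theorem exists_coeff_iteratedPDeriv [NoZeroDivisors R] [CharZero R] (s : σ →₀ ℕ)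
    (p : MvPolynomial σ R) (m : σ →₀ ℕ) :
    ∃ c : R, c ≠ 0 ∧ coeff m (iteratedPDeriv s p) = c * coeff (m + s) p := by
  induction s using induction_single_add generalizing m with
  | zero => exact ⟨1, one_ne_zero, by rw [iteratedPDeriv_zero, add_zero, one_mul]⟩
  | single_add i s ih =>
    obtain ⟨c, hc, h⟩ := ih (m + Finsupp.single i 1)
    refine ⟨c * (m i + 1), mul_ne_zero hc (Nat.cast_add_one_ne_zero _), ?_⟩
    rw [iteratedPDeriv_single_add, coeff_pderiv, h, add_assoc, mul_right_comm]

theorem totalDegree_pderiv_le (i : σ) (p : MvPolynomial σ R) :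
    (pderiv i p).totalDegree ≤ p.totalDegree - 1 := by
  refine Finset.sup_le fun s hs => Nat.le_sub_one_of_lt ?_
  rw [mem_support_iff, coeff_pderiv] at hs
  have hle : (s + Finsupp.single i 1).degree ≤ p.totalDegree :=
    le_totalDegree (mem_support_iff.2 (left_ne_zero_of_mul hs))
  rw [map_add, Finsupp.degree_single] at hle
  exact hle

theorem derivation_aeval {ι A M : Type*} [Fintype ι] [CommSemiring A] [Algebra R A]
    [AddCommMonoid M] [Module A M] [Module R M] (D : Derivation R A M) (g : ι → A)
    (p : MvPolynomial ι R) : D (aeval g p) = ∑ j, aeval g (pderiv j p) • D (g j) := by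
  classical
  induction p using MvPolynomial.induction_on with
  | C a => simp
  | add p q hp hq => simp only [map_add, hp, hq, add_smul, Finset.sum_add_distrib]
  | mul_X p i hp =>
    simp only [map_mul, Derivation.leibniz, hp, aeval_X, pderiv_X, smul_eq_mul, map_add, add_smul,
      Finset.sum_add_distrib, Finset.smul_sum, mul_smul, Pi.single_apply, apply_ite (aeval g),
      map_one, map_zero, ite_smul, one_smul, zero_smul, smul_ite, smul_zero, Finset.sum_ite_eq,
      Finset.mem_univ, if_true]

end IteratedDerivative

section ChainRule

variable {σ ι R : Type*} [CommSemiring R]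

theorem restrictTotalDegree_mul_restrictTotalDegree_le (a b : ℕ) :
    restrictTotalDegree σ R a * restrictTotalDegree σ R b ≤ restrictTotalDegree σ R (a + b) := by
  refine Submodule.mul_le.2 fun p hp q hq => ?_
  rw [mem_restrictTotalDegree] at *
  exact (totalDegree_mul _ _).trans (add_le_add hp hq)

/-- The span of the compositions with `g` of the derivatives of `C` of order at most `l`. -/
noncomputable def compDerivSpan (g : ι → MvPolynomial σ R) (C : MvPolynomial ι R) (l : ℕ) :
    Submodule R (MvPolynomial σ R) :=
  Submodule.span R ((fun s => aeval g (iteratedPDeriv s C)) '' {s | s.degree ≤ l})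

theorem aeval_iteratedPDeriv_mem_compDerivSpan (g : ι → MvPolynomial σ R) (C : MvPolynomial ι R)
    {s : ι →₀ ℕ} {l : ℕ} (hs : s.degree ≤ l) :
    aeval g (iteratedPDeriv s C) ∈ compDerivSpan g C l :=
  Submodule.subset_span ⟨s, hs, rfl⟩

theorem compDerivSpan_mono (g : ι → MvPolynomial σ R) (C : MvPolynomial ι R) :
    Monotone (compDerivSpan g C) := fun _ _ hl =>
  Submodule.span_mono (Set.image_mono fun _ hs => le_trans hs hl)

variable [Finite ι] {g : ι → MvPolynomial σ R} {d : ℕ}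

theorem compDerivSpan_le_comap_pderiv (hg : ∀ j, (g j).totalDegree ≤ d + 1)
    (C : MvPolynomial ι R) (i : σ) (l : ℕ) : compDerivSpan g C l ≤
      (restrictTotalDegree σ R d * compDerivSpan g C (l + 1)).comap (pderiv i).toLinearMap := by
  cases nonempty_fintype ι
  refine Submodule.span_le.2 ?_
  rintro _ ⟨s, hs, rfl⟩
  change pderiv i (aeval g (iteratedPDeriv s C)) ∈
    restrictTotalDegree σ R d * compDerivSpan g C (l + 1)
  rw [derivation_aeval]
  refine Submodule.sum_mem _ fun j _ => ?_
  rw [smul_eq_mul, mul_comm (aeval g _), ← iteratedPDeriv_single_add]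
  refine Submodule.mul_mem_mul ?_ (aeval_iteratedPDeriv_mem_compDerivSpan g C ?_)
  · exact (mem_restrictTotalDegree _ _ _).2 <|
      (totalDegree_pderiv_le _ _).trans (Nat.sub_le_of_le_add (hg j))
  · rw [map_add, Finsupp.degree_single, add_comm]
    exact Nat.succ_le_succ hs

theorem restrictTotalDegree_mul_compDerivSpan_le_comap_pderiv
    (hg : ∀ j, (g j).totalDegree ≤ d + 1) (C : MvPolynomial ι R) (i : σ) (a l : ℕ) :
    restrictTotalDegree σ R a * compDerivSpan g C l ≤
      (restrictTotalDegree σ R (a + d) * compDerivSpan g C (l + 1)).comap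
        (pderiv i).toLinearMap := by
  refine Submodule.mul_le.2 fun q hq w hw => ?_
  change pderiv i (q * w) ∈ restrictTotalDegree σ R (a + d) * compDerivSpan g C (l + 1)
  rw [pderiv_mul]
  refine add_mem (Submodule.mul_mem_mul ?_ (compDerivSpan_mono g C l.le_succ hw)) ?_
  · rw [mem_restrictTotalDegree] at *
    exact (totalDegree_pderiv_le _ _).trans ((Nat.sub_le _ _).trans (hq.trans le_self_add))
  · refine mul_le_mul_left (restrictTotalDegree_mul_restrictTotalDegree_le a d) _ ?_
    rw [mul_assoc]
    exact Submodule.mul_mem_mul hq (compDerivSpan_le_comap_pderiv hg C i l hw)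

theorem iteratedPDeriv_aeval_mem (hg : ∀ j, (g j).totalDegree ≤ d + 1) (C : MvPolynomial ι R)
    (s : σ →₀ ℕ) : iteratedPDeriv s (aeval g C) ∈
      restrictTotalDegree σ R (s.degree * d) * compDerivSpan g C s.degree := by
  induction s using induction_single_add with
  | zero =>
    rw [iteratedPDeriv_zero, ← one_mul (aeval g C), ← iteratedPDeriv_zero C]
    refine Submodule.mul_mem_mul ?_ (aeval_iteratedPDeriv_mem_compDerivSpan g C ?_)
    · rw [mem_restrictTotalDegree, totalDegree_one]
      exact Nat.zero_le _
    · exact le_rfl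
  | single_add i s ih =>
    rw [iteratedPDeriv_single_add, map_add, Finsupp.degree_single, add_comm 1, add_one_mul]
    exact restrictTotalDegree_mul_compDerivSpan_le_comap_pderiv hg C i _ _ ih

end ChainRule

section Dimension

/-- The exponent vectors of degree at most `n` supported in `S`. -/
def exponentsLE {σ : Type*} [DecidableEq σ] (S : Finset σ) (n : ℕ) : Finset (σ →₀ ℕ) :=
  (Finset.range (n + 1)).biUnion S.finsuppAntidiag

theorem mem_exponentsLE {σ : Type*} [DecidableEq σ] {S : Finset σ} {n : ℕ} {s : σ →₀ ℕ} :
    s ∈ exponentsLE S n ↔ s.degree ≤ n ∧ s.support ⊆ S := by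
  simp only [exponentsLE, Finset.mem_biUnion, Finset.mem_range_succ_iff,
    Finset.mem_finsuppAntidiag']
  exact ⟨fun ⟨_, hk, hs, hS⟩ => ⟨hs.trans_le hk, hS⟩, fun ⟨hs, hS⟩ => ⟨_, hs, rfl, hS⟩⟩

theorem card_exponentsLE {σ : Type*} [DecidableEq σ] (S : Finset σ) (n : ℕ) :
    (exponentsLE S n).card = (n + S.card).choose S.card := by
  rw [exponentsLE, Finset.card_biUnion, ← Nat.sum_range_multichoose]
  · simp only [Finset.card_finsuppAntidiag_nat_eq_multichoose]
  · intro a _ b _ hab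
    refine Finset.disjoint_left.2 fun s ha hb => hab ?_
    rw [← (Finset.mem_finsuppAntidiag.1 ha).1, (Finset.mem_finsuppAntidiag.1 hb).1]

theorem coe_exponentsLE_univ {σ : Type*} [DecidableEq σ] [Fintype σ] (n : ℕ) :
    (exponentsLE (Finset.univ : Finset σ) n : Set (σ →₀ ℕ)) = {s | s.degree ≤ n} := by
  ext s
  simp only [Finset.mem_coe, mem_exponentsLE, Finset.subset_univ, and_true, Set.mem_ofPred_eq]

variable {σ F : Type*} [Field F]

instance [Finite σ] (n : ℕ) : FiniteDimensional F (restrictTotalDegree σ F n) := by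
  classical
  cases nonempty_fintype σ
  have : Finite {s : σ →₀ ℕ | s.degree ≤ n} :=
    (Finset.finite_toSet _).subset (coe_exponentsLE_univ n).ge
  exact Module.Finite.of_basis (basisRestrictSupport F {s : σ →₀ ℕ | s.degree ≤ n})

theorem finrank_restrictTotalDegree [Fintype σ] (n : ℕ) :
    Module.finrank F (restrictTotalDegree σ F n) =
      (n + Fintype.card σ).choose (Fintype.card σ) := by
  classical
  rw [← Finset.card_univ, ← card_exponentsLE, ← Set.ncard_coe_finset, coe_exponentsLE_univ]
  exact Module.finrank_eq_nat_card_basis (basisRestrictSupport F {s : σ →₀ ℕ | s.degree ≤ n})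

variable {ι : Type*}

instance [Finite ι] (g : ι → MvPolynomial σ F) (C : MvPolynomial ι F) (l : ℕ) :
    FiniteDimensional F (compDerivSpan g C l) := by
  classical
  cases nonempty_fintype ι
  refine FiniteDimensional.span_of_finite F (Set.Finite.image _ ?_)
  exact (Finset.finite_toSet _).subset (coe_exponentsLE_univ l).ge

theorem finrank_compDerivSpan_le [Fintype ι] (g : ι → MvPolynomial σ F) (C : MvPolynomial ι F)
    (l : ℕ) :
    Module.finrank F (compDerivSpan g C l) ≤ (l + Fintype.card ι).choose (Fintype.card ι) := by
  classical
  rw [compDerivSpan, ← coe_exponentsLE_univ, ← Finset.coe_image]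
  refine (finrank_span_finset_le_card _).trans (Finset.card_image_le.trans ?_)
  rw [card_exponentsLE, Finset.card_univ]

instance {A : Type*} [Ring A] [Algebra F A] (M N : Submodule F A) [FiniteDimensional F M]
    [FiniteDimensional F N] : FiniteDimensional F ↥(M * N) :=
  Module.Finite.iff_fg.2 <|
    (Module.Finite.iff_fg.1 inferInstance).mul (Module.Finite.iff_fg.1 inferInstance)

theorem finrank_mul_le {A : Type*} [Ring A] [Algebra F A] (M N : Submodule F A)
    [FiniteDimensional F M] [FiniteDimensional F N] :
    Module.finrank F ↥(M * N) ≤ Module.finrank F M * Module.finrank F N := by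
  rw [← Submodule.mulMap_range, ← Module.finrank_tensorProduct (R := F) (S := F)]
  exact LinearMap.finrank_range_le _

theorem finrank_iSup_le_sum {κ V : Type*} [Fintype κ] [AddCommGroup V] [Module F V]
    (W : κ → Submodule F V) [∀ i, FiniteDimensional F (W i)] :
    Module.finrank F ↥(⨆ i, W i) ≤ ∑ i, Module.finrank F (W i) := by
  classical
  rw [← Finset.sup_univ_eq_iSup]
  induction (Finset.univ : Finset κ) using Finset.induction_on with
  | empty => simp
  | insert i s hi ih =>
    rw [Finset.sup_insert, Finset.sum_insert hi]
    exact (Submodule.finrank_add_le_finrank_add_finrank _ _).trans (Nat.add_le_add_left ih _)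

end Dimension

section ShiftedPartials

variable {σ F : Type*} [Field F]

/-- The span of the products of polynomials of degree at most `m` with the partial derivatives of
`P` of order `l`: the space of shifted partial derivatives, whose dimension measures the
complexity of `P`. -/
noncomputable def shiftedPDerivSpan (P : MvPolynomial σ F) (l m : ℕ) :
    Submodule F (MvPolynomial σ F) :=
  restrictTotalDegree σ F m *
    Submodule.span F ((fun s => iteratedPDeriv s P) '' {s | s.degree = l})

theorem mul_iteratedPDeriv_mem_shiftedPDerivSpan {q : MvPolynomial σ F} {m : ℕ}
    (hq : q.totalDegree ≤ m) (s : σ →₀ ℕ) (P : MvPolynomial σ F) :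
    q * iteratedPDeriv s P ∈ shiftedPDerivSpan P s.degree m :=
  Submodule.mul_mem_mul ((mem_restrictTotalDegree _ _ _).2 hq)
    (Submodule.subset_span ⟨s, rfl, rfl⟩)

theorem shiftedPDerivSpan_le {P : MvPolynomial σ F} {l m : ℕ}
    {W : Submodule F (MvPolynomial σ F)} (h : ∀ q : MvPolynomial σ F, q.totalDegree ≤ m →
      ∀ s : σ →₀ ℕ, s.degree = l → q * iteratedPDeriv s P ∈ W) :
    shiftedPDerivSpan P l m ≤ W := by
  rw [shiftedPDerivSpan, ← Submodule.span_eq (restrictTotalDegree σ F m), Submodule.span_mul_span,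
    Submodule.span_le]
  rintro _ ⟨q, hq, _, ⟨s, hs, rfl⟩, rfl⟩
  exact h q ((mem_restrictTotalDegree _ _ _).1 hq) s hs

instance [Finite σ] (P : MvPolynomial σ F) (l m : ℕ) :
    FiniteDimensional F (shiftedPDerivSpan P l m) := by
  classical
  cases nonempty_fintype σ
  have : FiniteDimensional F
      (Submodule.span F ((fun s => iteratedPDeriv s P) '' {s | s.degree = l})) := by
    refine FiniteDimensional.span_of_finite F (Set.Finite.image _ ?_)
    refine (Finset.finite_toSet (exponentsLE Finset.univ l)).subset ?_
    rw [coe_exponentsLE_univ]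
    exact fun s hs => hs.le
  unfold shiftedPDerivSpan
  infer_instance

theorem shiftedPDerivSpan_sum_le {ι : Type*} [Fintype ι] (q : ι → MvPolynomial σ F) (l m : ℕ) :
    shiftedPDerivSpan (∑ i, q i) l m ≤ ⨆ i, shiftedPDerivSpan (q i) l m := by
  refine shiftedPDerivSpan_le fun p hp s hs => ?_
  subst hs
  rw [map_sum, Finset.mul_sum]
  exact Submodule.sum_mem_iSup fun i => mul_iteratedPDeriv_mem_shiftedPDerivSpan hp s (q i)

theorem shiftedPDerivSpan_aeval_le {ι : Type*} [Finite ι] {g : ι → MvPolynomial σ F} {d : ℕ}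
    (hg : ∀ j, (g j).totalDegree ≤ d + 1) (C : MvPolynomial ι F) (l m : ℕ) :
    shiftedPDerivSpan (aeval g C) l m ≤
      restrictTotalDegree σ F (m + l * d) * compDerivSpan g C l := by
  refine shiftedPDerivSpan_le fun q hq s hs => ?_
  subst hs
  refine mul_le_mul_left (restrictTotalDegree_mul_restrictTotalDegree_le m _) _ ?_
  rw [mul_assoc]
  exact Submodule.mul_mem_mul ((mem_restrictTotalDegree _ _ _).2 hq)
    (iteratedPDeriv_aeval_mem hg C s)

variable [Fintype σ]

theorem finrank_shiftedPDerivSpan_le_of_mem_adjoin {G : Finset (MvPolynomial σ F)} {d n : ℕ}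
    (hG : ∀ g ∈ G, g.totalDegree ≤ d + 1) (hn : G.card ≤ n) {q : MvPolynomial σ F}
    (hq : q ∈ Algebra.adjoin F (G : Set (MvPolynomial σ F))) (l m : ℕ) :
    Module.finrank F (shiftedPDerivSpan q l m) ≤
      (m + l * d + Fintype.card σ).choose (Fintype.card σ) * (l + n).choose l := by
  rw [← Subtype.range_coe (s := (G : Set (MvPolynomial σ F))),
    Algebra.adjoin_range_eq_range_aeval] at hq
  obtain ⟨C, rfl⟩ := hq
  have hg : ∀ g : G, (g : MvPolynomial σ F).totalDegree ≤ d + 1 := fun g => hG g g.2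
  refine (Submodule.finrank_mono (shiftedPDerivSpan_aeval_le hg C l m)).trans ?_
  refine (finrank_mul_le _ _).trans (Nat.mul_le_mul (finrank_restrictTotalDegree _).le ?_)
  refine (finrank_compDerivSpan_le _ C l).trans ?_
  rw [← Nat.choose_symm_add]
  refine Nat.choose_le_choose l (Nat.add_le_add_left ?_ l)
  simpa using hn

theorem finrank_shiftedPDerivSpan_sum_le {ι : Type*} [Fintype ι]
    {G : ι → Finset (MvPolynomial σ F)} {d n : ℕ} (hG : ∀ i, ∀ g ∈ G i, g.totalDegree ≤ d + 1)
    (hn : ∀ i, (G i).card ≤ n) {q : ι → MvPolynomial σ F}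
    (hq : ∀ i, q i ∈ Algebra.adjoin F (G i : Set (MvPolynomial σ F))) (l m : ℕ) :
    Module.finrank F (shiftedPDerivSpan (∑ i, q i) l m) ≤ Fintype.card ι *
      ((m + l * d + Fintype.card σ).choose (Fintype.card σ) * (l + n).choose l) := by
  refine (Submodule.finrank_mono (shiftedPDerivSpan_sum_le q l m)).trans ?_
  refine (finrank_iSup_le_sum _).trans ?_
  refine (Finset.sum_le_card_nsmul _ _ _ fun i _ =>
    finrank_shiftedPDerivSpan_le_of_mem_adjoin (hG i) (hn i) (hq i) l m).trans_eq ?_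
  rw [Finset.card_univ, smul_eq_mul]

end ShiftedPartials

section TrailingMonomial

variable {σ F : Type*} [Field F] {m : MonomialOrder σ} {P : MvPolynomial σ F} {α : σ →₀ ℕ}

theorem IsTrailingMonomial.monomial_mul (h : IsTrailingMonomial m P α) (c : σ →₀ ℕ) :
    IsTrailingMonomial m (monomial c 1 * P) (c + α) := by
  refine ⟨?_, fun β hβ => ?_⟩
  · rw [mem_support_iff, coeff_monomial_mul, one_mul]
    exact mem_support_iff.1 h.1
  · rw [mem_support_iff, coeff_monomial_mul'] at hβ
    split_ifs at hβ with hc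
    · obtain ⟨γ, rfl⟩ := exists_add_of_le hc
      rw [one_mul, add_tsub_cancel_left] at hβ
      rw [map_add, map_add]
      exact add_le_add_right (h.2 γ (mem_support_iff.2 hβ)) _
    · exact absurd rfl hβ

theorem IsTrailingMonomial.iteratedPDeriv_of_le [CharZero F] (h : IsTrailingMonomial m P α)
    {s : σ →₀ ℕ} (hs : s ≤ α) : IsTrailingMonomial m (iteratedPDeriv s P) (α - s) := by
  refine ⟨?_, fun β hβ => ?_⟩
  · obtain ⟨a, ha, hcoeff⟩ := exists_coeff_iteratedPDeriv s P (α - s)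
    rw [mem_support_iff, hcoeff, tsub_add_cancel_of_le hs]
    exact mul_ne_zero ha (mem_support_iff.1 h.1)
  · obtain ⟨a, -, hcoeff⟩ := exists_coeff_iteratedPDeriv s P β
    rw [mem_support_iff, hcoeff] at hβ
    have hle := h.2 _ (mem_support_iff.2 (right_ne_zero_of_mul hβ))
    rw [← tsub_add_cancel_of_le hs, map_add, map_add] at hle
    exact le_of_add_le_add_right hle

theorem linearIndependent_of_isTrailingMonomial {ι : Type*} {v : ι → MvPolynomial σ F}
    {e : ι → σ →₀ ℕ} (h : ∀ i, IsTrailingMonomial m (v i) (e i)) (he : Function.Injective e) :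
    LinearIndependent F v := by
  classical
  rw [linearIndependent_iff']
  intro s g hg
  by_contra! hne
  have hs : (s.filter fun i => g i ≠ 0).Nonempty := Finset.filter_nonempty_iff.2 hne
  obtain ⟨i, hi, hmin⟩ := Finset.exists_min_image _ (fun i => m.toSyn (e i)) hs
  rw [Finset.mem_filter] at hi
  have hcoeff := congrArg (coeff (e i)) hg
  rw [coeff_sum, coeff_zero, Finset.sum_eq_single_of_mem i hi.1, coeff_smul] at hcoeff
  · exact smul_ne_zero hi.2 (mem_support_iff.1 (h i).1) hcoeff
  · intro j hj hji
    rw [coeff_smul]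
    by_contra! hc
    have hij := hmin j (Finset.mem_filter.2 ⟨hj, left_ne_zero_of_smul hc⟩)
    have hji' := (h j).2 _ (mem_support_iff.2 (right_ne_zero_of_smul hc))
    exact hji (he (m.toSyn.injective (le_antisymm hji' hij)))

theorem exists_isTrailingMonomial (m : MonomialOrder σ) (hP : P ≠ 0) :
    ∃ α, IsTrailingMonomial m P α :=
  Finset.exists_min_image _ m.toSyn (support_nonempty.2 hP)

/-- The exponent vector of the product of the variables in `B`. -/
noncomputable def squarefreeExponent (B : Finset σ) : σ →₀ ℕ := Finsupp.indicator B fun _ _ => 1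

theorem squarefreeExponent_apply [DecidableEq σ] (B : Finset σ) (i : σ) :
    squarefreeExponent B i = if i ∈ B then 1 else 0 := by
  simp only [squarefreeExponent, Finsupp.indicator_apply, dite_eq_ite]

theorem squarefreeExponent_le (hα : ∀ i, α i ≠ 0) (B : Finset σ) : squarefreeExponent B ≤ α :=
  fun i => by
    classical
    have hαi := hα i
    rw [squarefreeExponent_apply]
    split_ifs <;> lia

theorem degree_squarefreeExponent (B : Finset σ) : (squarefreeExponent B).degree = B.card := by
  classical
  have hsupp : (squarefreeExponent B).support ⊆ B := Finsupp.support_indicator_subset B _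
  rw [Finsupp.degree_apply, Finset.card_eq_sum_ones,
    Finset.sum_subset hsupp fun _ _ => Finsupp.notMem_support_iff.1]
  exact Finset.sum_congr rfl fun i hi => by rw [squarefreeExponent_apply, if_pos hi]

variable [Fintype σ]

/-- The index set of a linearly independent family of shifted partial derivatives: the pairs of
a set `B` of `l` variables, with respect to each of which one differentiates once, and of a
monomial of degree at most `n` in the other variables, with which one multiplies. -/
def shiftIndices (σ : Type*) [Fintype σ] [DecidableEq σ] (l n : ℕ) :
    Finset (Σ _ : Finset σ, σ →₀ ℕ) :=
  (Finset.powersetCard l Finset.univ).sigma fun B => exponentsLE Bᶜ n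

theorem card_shiftIndices [DecidableEq σ] (l n : ℕ) : (shiftIndices σ l n).card =
    (Fintype.card σ).choose l * (n + (Fintype.card σ - l)).choose (Fintype.card σ - l) := by
  rw [shiftIndices, Finset.card_sigma, Finset.sum_congr rfl fun B hB => by
    rw [card_exponentsLE, Finset.card_compl, (Finset.mem_powersetCard.1 hB).2],
    Finset.sum_const, Finset.card_powersetCard, Finset.card_univ, smul_eq_mul]

theorem injOn_add_sub_squarefreeExponent [DecidableEq σ] (hα : ∀ i, α i ≠ 0) (l n : ℕ) :
    Set.InjOn (fun x : Σ _ : Finset σ, σ →₀ ℕ =>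
      x.2 + (α - squarefreeExponent x.1)) (shiftIndices σ l n) := by
  intro x hx y hy hxy
  have mem_iff_lt {z : Σ _ : Finset σ, σ →₀ ℕ} (hz : z ∈ shiftIndices σ l n) (i : σ) : i ∈ z.1 ↔
      (z.2 + (α - squarefreeExponent z.1) : σ →₀ ℕ) i < α i := by
    have hdisj : i ∈ z.1 → z.2 i = 0 := fun hi => Finsupp.notMem_support_iff.1 fun hi' =>
      Finset.mem_compl.1 ((mem_exponentsLE.1 (Finset.mem_sigma.1 hz).2).2 hi') hi
    have hαi := hα i
    rw [Finsupp.add_apply, Finsupp.tsub_apply, squarefreeExponent_apply]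
    split_ifs with hi
    · have := hdisj hi
      exact iff_of_true hi (by lia)
    · exact iff_of_false hi (by lia)
  have hfst : x.1 = y.1 := Finset.ext fun i => by
    rw [mem_iff_lt hx, mem_iff_lt hy]
    exact iff_of_eq (congrArg (fun e : σ →₀ ℕ => e i < α i) hxy)
  obtain ⟨B, c⟩ := x
  obtain ⟨B', c'⟩ := y
  obtain rfl : B = B' := hfst
  exact congrArg _ (add_right_cancel hxy)

theorem monomial_mul_iteratedPDeriv_mem_of_mem_shiftIndices [DecidableEq σ] {l n : ℕ}
    {x : Σ _ : Finset σ, σ →₀ ℕ} (hx : x ∈ shiftIndices σ l n) (P : MvPolynomial σ F) :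
    monomial x.2 1 * iteratedPDeriv (squarefreeExponent x.1) P ∈ shiftedPDerivSpan P l n := by
  obtain ⟨hB, hc⟩ := Finset.mem_sigma.1 hx
  rw [← (Finset.mem_powersetCard.1 hB).2, ← degree_squarefreeExponent x.1]
  refine mul_iteratedPDeriv_mem_shiftedPDerivSpan ?_ _ P
  exact (totalDegree_monomial_le _ _).trans (mem_exponentsLE.1 hc).1

theorem IsTrailingMonomial.choose_mul_choose_le_finrank [CharZero F]
    (h : IsTrailingMonomial m P α) (hα : ∀ i, α i ≠ 0) (l n : ℕ) :
    (Fintype.card σ).choose l * (n + (Fintype.card σ - l)).choose (Fintype.card σ - l) ≤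
      Module.finrank F (shiftedPDerivSpan P l n) := by
  classical
  have hv : LinearIndependent F fun x : shiftIndices σ l n =>
      monomial x.1.2 1 * iteratedPDeriv (squarefreeExponent x.1.1) P :=
    linearIndependent_of_isTrailingMonomial
      (fun x => (h.iteratedPDeriv_of_le (squarefreeExponent_le hα x.1.1)).monomial_mul x.1.2)
      fun x y hxy => Subtype.ext (injOn_add_sub_squarefreeExponent hα l n x.2 y.2 hxy)
  have hw : LinearIndependent F fun x : shiftIndices σ l n =>
      (⟨_, monomial_mul_iteratedPDeriv_mem_of_mem_shiftIndices x.2 P⟩ :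
        shiftedPDerivSpan P l n) :=
    LinearIndependent.of_comp (shiftedPDerivSpan P l n).subtype hv
  rw [← card_shiftIndices, ← Fintype.card_coe]
  exact hw.fintype_card_le_finrank

end TrailingMonomial

section Restriction

variable {σ τ : Type*} {f : σ → τ}

/-- The monomial order on the variables indexed by `σ` induced by a monomial order on the
variables indexed by `τ` along an injection of `σ` into `τ`. -/
noncomputable def comapMonomialOrder (hf : Function.Injective f) (m : MonomialOrder τ) :
    MonomialOrder σ where
  syn := AddMonoidHom.mrange
    ((m.toSyn : (τ →₀ ℕ) →+ m.syn).comp (Finsupp.mapDomain.addMonoidHom f))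
  addCommMonoidSyn := inferInstance
  toSyn := AddEquiv.ofBijective
    ((m.toSyn : (τ →₀ ℕ) →+ m.syn).comp (Finsupp.mapDomain.addMonoidHom f)).mrangeRestrict
    ⟨fun _ _ h => Finsupp.mapDomain_injective hf (m.toSyn.injective (Subtype.ext_iff.1 h)),
      AddMonoidHom.mrangeRestrict_surjective _⟩
  toSyn_monotone _ _ h := m.toSyn_monotone (Finsupp.mapDomain_mono h)

theorem comapMonomialOrder_le_iff (hf : Function.Injective f) {m : MonomialOrder τ}
    {β γ : σ →₀ ℕ} : β ≼[comapMonomialOrder hf m] γ ↔ β.mapDomain f ≼[m] γ.mapDomain f :=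
  Iff.rfl

variable {F : Type*} [Field F]

theorem IsTrailingMonomial.killCompl_of_mapDomain {m : MonomialOrder τ} {P : MvPolynomial τ F}
    {α : σ →₀ ℕ} (hf : Function.Injective f) (h : IsTrailingMonomial m P (α.mapDomain f)) :
    IsTrailingMonomial (comapMonomialOrder hf m) (killCompl hf P) α := by
  refine ⟨?_, fun β hβ => ?_⟩
  · rw [mem_support_iff, coeff_killCompl]
    exact mem_support_iff.1 h.1
  · rw [mem_support_iff, coeff_killCompl] at hβ
    exact (comapMonomialOrder_le_iff hf).2 (h.2 _ (mem_support_iff.2 hβ))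

theorem totalDegree_killCompl_le (hf : Function.Injective f) (p : MvPolynomial τ F) :
    (killCompl hf p).totalDegree ≤ p.totalDegree := by
  refine totalDegree_aeval_le_of_forall_le_one (fun i => ?_) p
  split_ifs
  · exact (totalDegree_X _).le
  · exact totalDegree_zero.trans_le zero_le_one

theorem IsTrailingMonomial.choose_card_support_mul_choose_le [CharZero F] {m : MonomialOrder σ}
    {ι : Type*} [Fintype ι] {q : ι → MvPolynomial σ F} {α : σ →₀ ℕ}
    (h : IsTrailingMonomial m (∑ i, q i) α) {G : ι → Finset (MvPolynomial σ F)} {d n : ℕ}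
    (hG : ∀ i, ∀ g ∈ G i, g.totalDegree ≤ d + 1) (hn : ∀ i, (G i).card ≤ n)
    (hq : ∀ i, q i ∈ Algebra.adjoin F (G i : Set (MvPolynomial σ F))) (l r : ℕ) :
    α.support.card.choose l * (r + (α.support.card - l)).choose (α.support.card - l) ≤
      Fintype.card ι *
        ((r + l * d + α.support.card).choose α.support.card * (l + n).choose l) := by
  classical
  have hval : Function.Injective (Subtype.val : α.support → σ) := Subtype.val_injective
  have hα : (α.comapDomain Subtype.val hval.injOn : α.support →₀ ℕ).mapDomain Subtype.val = α :=
    Finsupp.mapDomain_comapDomain _ hval _ Subtype.range_coe.ge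
  rw [← hα] at h
  have hrestr := h.killCompl_of_mapDomain hval
  rw [map_sum] at hrestr
  have hlower := hrestr.choose_mul_choose_le_finrank
    (fun i => (Finsupp.mem_support_iff (f := α)).1 i.2) l r
  have hupper := finrank_shiftedPDerivSpan_sum_le
    (G := fun i => (G i).image (killCompl hval)) (q := fun i => killCompl hval (q i))
    (fun i => Finset.forall_mem_image.2 fun g hg =>
      (totalDegree_killCompl_le hval g).trans (hG i g hg))
    (fun i => Finset.card_image_le.trans (hn i))
    (fun i => by
      rw [Finset.coe_image, ← AlgHom.map_adjoin]
      exact Subalgebra.mem_map.2 ⟨_, hq i, rfl⟩) l r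
  simpa only [Fintype.card_coe] using hlower.trans hupper

end Restriction

section BinomialEstimates

theorem choose_add_mul_pow_le (N M j : ℕ) :
    (M + j + N).choose N * M ^ j ≤ (M + N).choose N * (M + N) ^ j := by
  induction j with
  | zero => rfl
  | succ j ih =>
    have step : (M + j + 1 + N).choose N * M ≤ (M + j + N).choose N * (M + N) := by
      have hratio : (M + j + N).choose N * (M + j + N + 1) =
          (M + j + 1 + N).choose N * (M + j + 1) := by
        rw [Nat.choose_mul_succ_eq]
        congr 2 <;> lia
      refine Nat.le_of_mul_le_mul_right (c := M + j + 1) ?_ (by lia)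
      calc (M + j + 1 + N).choose N * M * (M + j + 1)
          = (M + j + N).choose N * (M * (M + j + N + 1)) := by rw [mul_right_comm, ← hratio]; ring
        _ ≤ (M + j + N).choose N * ((M + N) * (M + j + 1)) :=
          Nat.mul_le_mul_left _ (by nlinarith)
        _ = _ := (mul_assoc _ _ _).symm
    calc (M + j + 1 + N).choose N * M ^ (j + 1)
        = (M + j + 1 + N).choose N * M * M ^ j := by ring
      _ ≤ (M + j + N).choose N * (M + N) * M ^ j := by gcongr
      _ = (M + j + N).choose N * M ^ j * (M + N) := by ring
      _ ≤ (M + N).choose N * (M + N) ^ j * (M + N) := by gcongr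
      _ = _ := by ring

theorem add_one_pow_le_exp_mul_pow (d : ℕ) : ((d : ℝ) + 1) ^ d ≤ Real.exp 1 * d ^ d := by
  obtain rfl | hd := eq_or_ne d 0
  · simp
  · calc ((d : ℝ) + 1) ^ d = (1 + (d : ℝ)⁻¹) ^ d * d ^ d := by
          rw [← mul_pow, one_add_mul, inv_mul_cancel₀ (by positivity)]
      _ ≤ Real.exp 1 * d ^ d := by gcongr; exact Real.one_add_inv_pow_le_exp

theorem choose_add_mul_le_exp_pow_mul_choose {N : ℕ} (hN : 0 < N) (d l : ℕ) :
    ((N * d + l * d + N).choose N : ℝ) ≤ Real.exp 1 ^ l * (N * d + N).choose N := by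
  have hgrowth : ((N * d + l * d + N).choose N : ℝ) * (N * d : ℝ) ^ (l * d) ≤
      (N * d + N).choose N * (N * d + N : ℝ) ^ (l * d) :=
    mod_cast choose_add_mul_pow_le N (N * d) (l * d)
  have hd : (0 : ℝ) < d ^ d := mod_cast d.pow_self_pos
  refine le_of_mul_le_mul_right ?_ (by positivity : (0 : ℝ) < N ^ (l * d) * (d ^ d) ^ l)
  calc _ = ((N * d + l * d + N).choose N : ℝ) * (N * d : ℝ) ^ (l * d) := by
        rw [mul_pow, mul_comm l d, pow_mul (d : ℝ)]
    _ ≤ _ := hgrowth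
    _ = (N * d + N).choose N * N ^ (l * d) * (((d : ℝ) + 1) ^ d) ^ l := by
        rw [← mul_add_one (N : ℝ), mul_pow, mul_comm l d, pow_mul ((d : ℝ) + 1), mul_assoc]
    _ ≤ (N * d + N).choose N * N ^ (l * d) * (Real.exp 1 * d ^ d) ^ l := by
        gcongr
        exact add_one_pow_le_exp_mul_pow d
    _ = _ := by rw [mul_pow]; ring

theorem choose_mul_factorial_mul_choose_le {N l : ℕ} (hl : l ≤ N) (M : ℕ) :
    (M + N).choose N * (l.factorial * N.choose l) ≤
      (M + (N - l)).choose (N - l) * (M + N) ^ l := by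
  have hchoose := Nat.choose_mul (n := M + N) hl
  rw [Nat.add_sub_assoc hl] at hchoose
  calc (M + N).choose N * (l.factorial * N.choose l)
      = l.factorial * ((M + N).choose N * N.choose l) := by ring
    _ = (M + (N - l)).choose (N - l) * (M + N).descFactorial l := by
        rw [hchoose, Nat.descFactorial_eq_factorial_mul_choose]; ring
    _ ≤ _ := Nat.mul_le_mul_left _ (Nat.descFactorial_le_pow _ _)

theorem pow_le_pow_mul_choose {N l : ℕ} (hl : l ≤ N) : N ^ l ≤ l ^ l * N.choose l := by
  refine Nat.le_of_mul_le_mul_right (c := l.factorial) ?_ l.factorial_pos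
  calc N ^ l * l.factorial = ∏ i ∈ Finset.range l, N * (l - i) := by
        rw [Finset.prod_mul_distrib, Finset.prod_const, Finset.card_range,
          ← Nat.descFactorial_eq_prod_range, Nat.descFactorial_self]
    _ ≤ ∏ i ∈ Finset.range l, l * (N - i) := Finset.prod_le_prod' fun i _ => by
        rw [Nat.mul_sub, Nat.mul_sub, mul_comm l N]
        exact Nat.sub_le_sub_left (Nat.mul_le_mul_right i hl) _
    _ = l ^ l * N.choose l * l.factorial := by
        rw [Finset.prod_mul_distrib, Finset.prod_const, Finset.card_range,
          ← Nat.descFactorial_eq_prod_range, Nat.descFactorial_eq_factorial_mul_choose]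
        ring

theorem pow_self_le_exp_pow_mul_factorial (l : ℕ) :
    (l : ℝ) ^ l ≤ Real.exp 1 ^ l * l.factorial := by
  rw [← Real.exp_nat_mul, mul_one, ← div_le_iff₀ (by positivity)]
  exact Real.pow_div_factorial_le_exp l l.cast_nonneg l

theorem pow_le_choose_sq_mul_factorial {N l : ℕ} (hl : l ≤ N) {c : ℝ} (hc : 0 ≤ c)
    (h : Real.exp 1 * c * l ≤ N) : (c * N) ^ l ≤ (N.choose l : ℝ) ^ 2 * l.factorial := by
  have hchoose : (N : ℝ) ^ l ≤ l ^ l * N.choose l := mod_cast pow_le_pow_mul_choose hl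
  have hll : (0 : ℝ) < l ^ l := mod_cast l.pow_self_pos
  refine le_of_mul_le_mul_right ?_ (by positivity : (0 : ℝ) < Real.exp 1 ^ l * (l ^ l) ^ 2)
  calc (c * N : ℝ) ^ l * (Real.exp 1 ^ l * (l ^ l) ^ 2)
      = (Real.exp 1 * c * l) ^ l * N ^ l * l ^ l := by simp only [mul_pow]; ring
    _ ≤ N ^ l * N ^ l * (Real.exp 1 ^ l * l.factorial) := by
        gcongr
        exact pow_self_le_exp_pow_mul_factorial l
    _ ≤ (l ^ l * N.choose l) * (l ^ l * N.choose l) * (Real.exp 1 ^ l * l.factorial) := by gcongr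
    _ = _ := by ring

theorem two_exp_pow_mul_choose_le {N l d : ℕ} (hN : 0 < N) (hl : l ≤ N)
    (h : 2 * Real.exp 1 ^ 3 * (d + 1) * l ≤ N) :
    (2 * Real.exp 1) ^ l * ((N * d + l * d + N).choose N : ℝ) ≤
      N.choose l * (N * d + (N - l)).choose (N - l) := by
  have hgrowth := choose_add_mul_le_exp_pow_mul_choose hN d l
  have hmain : ((N * d + N).choose N : ℝ) * (l.factorial * N.choose l) ≤
      (N * d + (N - l)).choose (N - l) * (N * (d + 1)) ^ l := by
    rw [mul_add_one (N : ℝ)]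
    exact_mod_cast choose_mul_factorial_mul_choose_le hl (N * d)
  have hpow := pow_le_choose_sq_mul_factorial hl
    (by positivity : 0 ≤ 2 * Real.exp 1 ^ 2 * ((d : ℝ) + 1)) (by linarith)
  have hpos : (0 : ℝ) < l.factorial * N.choose l := by
    exact_mod_cast Nat.mul_pos l.factorial_pos (Nat.choose_pos hl)
  refine le_of_mul_le_mul_right ?_ hpos
  calc _ ≤ (2 * Real.exp 1) ^ l * (Real.exp 1 ^ l * ((N * d + N).choose N)) *
          (l.factorial * N.choose l) := by gcongr
    _ = (2 * Real.exp 1 ^ 2) ^ l * ((N * d + N).choose N * (l.factorial * N.choose l)) := by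
        simp only [mul_pow]; ring
    _ ≤ (2 * Real.exp 1 ^ 2) ^ l *
          ((N * d + (N - l)).choose (N - l) * (N * (d + 1)) ^ l) := by gcongr
    _ = (N * d + (N - l)).choose (N - l) * (2 * Real.exp 1 ^ 2 * (d + 1) * N) ^ l := by
        simp only [mul_pow]; ring
    _ ≤ (N * d + (N - l)).choose (N - l) * ((N.choose l : ℝ) ^ 2 * l.factorial) := by gcongr
    _ = _ := by ring

theorem exp_pow_le_mul_two_pow {N n T d l : ℕ} (hN : 0 < N) (hl : l ≤ N)
    (hlN : 2 * Real.exp 1 ^ 3 * (d + 1) * l ≤ N)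
    (h : N.choose l * (N * d + (N - l)).choose (N - l) ≤
      T * ((N * d + l * d + N).choose N * (l + n).choose l)) :
    Real.exp 1 ^ l ≤ T * 2 ^ n := by
  have hpos : (0 : ℝ) < 2 ^ l * (N * d + l * d + N).choose N := by
    have := Nat.choose_pos (Nat.le_add_left N (N * d + l * d))
    positivity
  refine le_of_mul_le_mul_right ?_ hpos
  calc _ = (2 * Real.exp 1) ^ l * ((N * d + l * d + N).choose N : ℝ) := by rw [mul_pow]; ring
    _ ≤ N.choose l * (N * d + (N - l)).choose (N - l) := two_exp_pow_mul_choose_le hN hl hlN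
    _ ≤ T * ((N * d + l * d + N).choose N * (l + n).choose l) := mod_cast h
    _ ≤ T * ((N * d + l * d + N).choose N * 2 ^ (l + n)) := by
        gcongr
        exact_mod_cast Nat.choose_le_two_pow (l + n) l
    _ = _ := by ring

theorem le_of_forall_choose_mul_choose_le {N n T d : ℕ}
    (h : ∀ l r, N.choose l * (r + (N - l)).choose (N - l) ≤
      T * ((r + l * d + N).choose N * (l + n).choose l)) :
    (N : ℝ) ≤ 2 * Real.exp 1 ^ 3 * (d + 1) * (Real.log T + n * Real.log 2 + 1) := by
  have hT : 0 < T := Nat.pos_of_ne_zero fun hT => by simpa [hT] using h 0 0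
  set L := Real.log T + n * Real.log 2 + 1
  have hL : 1 ≤ L := le_add_of_nonneg_left (by positivity)
  by_contra! hlt
  have hlL : (⌊L⌋₊ : ℝ) ≤ L := Nat.floor_le (by linarith)
  have hbound : 2 * Real.exp 1 ^ 3 * (d + 1) * ⌊L⌋₊ ≤ N :=
    (mul_le_mul_of_nonneg_left hlL (by positivity)).trans hlt.le
  have hfactor : 1 ≤ 2 * Real.exp 1 ^ 3 * ((d : ℝ) + 1) := by
    have := one_le_pow₀ (Real.one_le_exp zero_le_one) (n := 3)
    nlinarith [d.cast_nonneg (α := ℝ)]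
  have hlN : ⌊L⌋₊ ≤ N := by
    exact_mod_cast (le_mul_of_one_le_left (by positivity) hfactor).trans hbound
  have hN : 0 < N := (Nat.floor_pos.2 hL).trans_le hlN
  have hexp := exp_pow_le_mul_two_pow hN hlN hbound (h _ _)
  rw [← Real.exp_nat_mul, mul_one, ← Real.le_log_iff_exp_le (by positivity),
    Real.log_mul (by positivity) (by positivity), Real.log_pow] at hexp
  linarith [Nat.lt_floor_add_one L]

end BinomialEstimates

section SupportBound

variable {σ ι F : Type*} [Fintype ι] [Field F] {m : MonomialOrder σ}

theorem totalDegree_eq_zero_of_mem_adjoin {S : Set (MvPolynomial σ F)}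
    (hS : ∀ g ∈ S, g.totalDegree = 0) {q : MvPolynomial σ F} (hq : q ∈ Algebra.adjoin F S) :
    q.totalDegree = 0 := by
  have hle : Algebra.adjoin F S ≤ ⊥ := Algebra.adjoin_le fun g hg =>
    Algebra.mem_bot.2 ⟨_, (totalDegree_eq_zero_iff_eq_C.1 (hS g hg)).symm⟩
  obtain ⟨c, rfl⟩ := Algebra.mem_bot.1 (hle hq)
  exact totalDegree_C c

theorem IsTrailingMonomial.eq_zero_of_totalDegree_eq_zero {P : MvPolynomial σ F} {α : σ →₀ ℕ}
    (h : IsTrailingMonomial m P α) (hP : P.totalDegree = 0) : α = 0 :=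
  (Finsupp.degree_eq_zero_iff α).1 (Nat.le_zero.1 ((le_totalDegree h.1).trans hP.le))

theorem IsTrailingMonomial.card_support_le [CharZero F] {q : ι → MvPolynomial σ F} {α : σ →₀ ℕ}
    (h : IsTrailingMonomial m (∑ i, q i) α) {G : ι → Finset (MvPolynomial σ F)} {d n : ℕ}
    (hG : ∀ i, ∀ g ∈ G i, g.totalDegree ≤ d) (hn : ∀ i, (G i).card ≤ n)
    (hq : ∀ i, q i ∈ Algebra.adjoin F (G i : Set (MvPolynomial σ F))) :
    (α.support.card : ℝ) ≤ 2 * Real.exp 1 ^ 3 * d *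
      (Real.log (Fintype.card ι) + n * Real.log 2 + 1) := by
  obtain _ | d := d
  · have hsum : (∑ i, q i).totalDegree = 0 := Nat.le_zero.1 <| totalDegree_finsetSum_le fun i _ =>
      (totalDegree_eq_zero_of_mem_adjoin (fun g hg => Nat.le_zero.1 (hG i g hg)) (hq i)).le
    simp [h.eq_zero_of_totalDegree_eq_zero hsum]
  · rw [Nat.cast_succ]
    exact le_of_forall_choose_mul_choose_le (h.choose_card_support_mul_choose_le hG hn hq)

theorem lemma5p2_general {κ : Type*} [CharZero F] (m : MonomialOrder σ) {d k Δ : ℕ}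
    {P : MvPolynomial σ F} (hP0 : P ≠ 0) (hP : P.IsHomogeneous Δ) (C : ι → MvPolynomial κ F)
    (Q : ι → κ → MvPolynomial σ F) (hrep : P = ∑ i, aeval (Q i) (C i))
    (hdeg : ∀ i j, (Q i j).totalDegree ≤ d)
    (hrank : ∀ i, algebraicRank (Set.range (Q i)) ≤ (k : ℕ∞)) :
    ∃ α : σ →₀ ℕ, IsTrailingMonomial m P α ∧
      (α.support.card : ℝ) ≤ 2 * Real.exp 1 ^ 3 * d *
        (Real.log (Fintype.card ι) + (d + 1) * k * Real.log 2 + 1) := by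
  obtain ⟨α, hα⟩ := exists_isTrailingMonomial m hP0
  obtain ⟨G, q, hcard, hG, hq, rfl⟩ := exists_sum_eq_of_algebraicRank_le hP hrep hdeg hrank
  exact ⟨α, hα, by exact_mod_cast hα.card_support_le hG hcard hq⟩

theorem log_natCast_le_log_mul_add_one (T Δ : ℕ) :
    Real.log T ≤ Real.log ((T : ℝ) * ((Δ : ℝ) + 1)) := by
  obtain rfl | hT := eq_or_ne T 0
  · simp
  · exact Real.log_le_log (by positivity) (le_mul_of_one_le_right (by positivity) (by simp))

theorem natCast_mul_log_two_le (d k : ℕ) : ((d : ℝ) + 1) * k * Real.log 2 ≤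
    ((d : ℝ) + 1) * k * Real.log (2 * ((d : ℝ) + 1) * k) := by
  obtain rfl | hk := eq_or_ne k 0
  · simp
  · have hk' : (1 : ℝ) ≤ k := mod_cast Nat.one_le_iff_ne_zero.2 hk
    gcongr
    nlinarith [d.cast_nonneg (α := ℝ)]

end SupportBound

theorem lemma5p2 {F : Type*} [Field F] [CharZero F] (N T t d k Δ : ℕ)
    (m : MonomialOrder (Fin N))
    (P : MvPolynomial (Fin N) F) (hP0 : P ≠ 0) (hP : P.IsHomogeneous Δ)
    (C : Fin T → MvPolynomial (Fin t) F)
    (Q : Fin T → Fin t → MvPolynomial (Fin N) F)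
    (hrep : P = ∑ i, aeval (Q i) (C i))
    (hdeg : ∀ i j, (Q i j).totalDegree ≤ d)
    (hrank : ∀ i, algebraicRank (Set.range (Q i)) ≤ (k : ℕ∞)) :
    ∃ α : Fin N →₀ ℕ, IsTrailingMonomial m P α ∧
      (α.support.card : ℝ) ≤
        2 * Real.exp 1 ^ 3 * (d : ℝ) *
          (Real.log ((T : ℝ) * ((Δ : ℝ) + 1)) +
            ((d : ℝ) + 1) * (k : ℝ) * Real.log (2 * ((d : ℝ) + 1) * (k : ℝ)) + 1) := by
  obtain ⟨α, hα, hcard⟩ := lemma5p2_general m hP0 hP C Q hrep hdeg hrank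
  rw [Fintype.card_fin] at hcard
  refine ⟨α, hα, hcard.trans ?_⟩
  gcongr _ * (?_ + ?_ + 1)
  · exact log_natCast_le_log_mul_add_one T Δ
  · exact natCast_mul_log_two_le d k
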